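/- Let $a<b$, $c<d$ and let $f\colon [a,b]\times [c,d]\to\mathbb{R}$ be such that $f(x,\cdot)\colon[c,d]\to\mathbb{R}$ is absolutely continuous for every $x\in[a,b]$ and $f(\cdot,y)\colon[a,b]\to\mathbb{R}$ is absolutely continuous for every $y\in[c,d]$. Write $\vert\cdot\vert$ for Lebesgue measure, and $\partial_1,\partial_2$ for the partial derivatives with respect to the first and second variable. The following properties are equivalent: (i) There is a Lebesgue measurable set $e_1\subset(a,b)$ with $\vert e_1\vert=b-a$ such that for every $x\in e_1$ the partial derivative $\partial_1 f(x,y)$ exists for every $y\in[c,d]$ and $\partial_1 f(x,\cdot)$ is absolutely continuous over $[c,d]$; moreover $\partial_2\partial_1 f\in L^1([a,b]\times[c,d])$. (ii) There is a Lebesgue measurable set $e_2\subset(c,d)$ with $\vert e_2\vert=d-c$ such that for every $y\in e_2$ the partial derivative $\partial_2 f(x,y)$ exists for every $x\in[a,b]$ and $\partial_2 f(\cdot,y)$ is absolutely continuous over $[a,b]$; moreover $\partial_1\partial_2 f\in L^1([a,b]\times[c,d])$. Suppose they hold, and let $e_1$ and $e_2$ be any sets as in (i) and (ii). Then there is a measurable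 subset $E\subset e_1\times e_2$ with $\vert E\vert=(b-a)(d-c)$ such that at every point of $E$ the function $f$ is differentiable, $\partial_2\partial_1 f$ and $\partial_1\partial_2 f$ exist, and $$\partial_2\partial_1 f=\partial_1\partial_2 f.$$ -/

import Mathlib

open Set MeasureTheory

noncomputable section

/-- The partial derivative `∂₁ g` with respect to the first variable
(with the usual value `0` at the points where it does not exist). -/
def partialFst (g : ℝ × ℝ → ℝ) (p : ℝ × ℝ) : ℝ := deriv (fun u => g (u, p.2)) p.1

/-- The partial derivative `∂₂ g` with respect to the second variable
(with the usual value `0` at the points where it does not exist). -/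
def partialSnd (g : ℝ × ℝ → ℝ) (p : ℝ × ℝ) : ℝ := deriv (fun v => g (p.1, v)) p.2

/-- `∂₁ g` exists at `p`. -/
def HasPartialFst (g : ℝ × ℝ → ℝ) (p : ℝ × ℝ) : Prop :=
  DifferentiableAt ℝ (fun u => g (u, p.2)) p.1

/-- `∂₂ g` exists at `p`. -/
def HasPartialSnd (g : ℝ × ℝ → ℝ) (p : ℝ × ℝ) : Prop :=
  DifferentiableAt ℝ (fun v => g (p.1, v)) p.2

/-- `e` is a Lebesgue measurable subset of `(a, b)` with `|e| = b - a`. -/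
structure IsFullIn (e : Set ℝ) (a b : ℝ) : Prop where
  subset : e ⊆ Ioo a b
  measurable : NullMeasurableSet e volume
  measure_eq : volume e = ENNReal.ofReal (b - a)

/-- The set `e₁ ⊆ (a, b)` has full measure; for every `x ∈ e₁`, the partial derivative
`∂₁ f (x, y)` exists for every `y ∈ [c, d]` and is absolutely continuous in `y` over `[c, d]`;
and `∂₂ ∂₁ f ∈ L¹([a, b] × [c, d])`. All of these depend only on the values of `f` on
`[a, b] × [c, d]`, since `e₁` lies in the open interval and the boundary is a null set. -/
structure MixedCondFst (f : ℝ × ℝ → ℝ) (a b c d : ℝ) (e₁ : Set ℝ) : Prop where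
  full : IsFullIn e₁ a b
  hasPartial : ∀ x ∈ e₁, ∀ y ∈ Icc c d, HasPartialFst f (x, y)
  absCont : ∀ x ∈ e₁, AbsolutelyContinuousOnInterval (fun y => partialFst f (x, y)) c d
  integrable : IntegrableOn (partialSnd (partialFst f)) (Icc a b ×ˢ Icc c d) volume

/-- The set `e₂ ⊆ (c, d)` has full measure; for every `y ∈ e₂`, the partial derivative
`∂₂ f (x, y)` exists for every `x ∈ [a, b]` and is absolutely continuous in `x` over `[a, b]`;
and `∂₁ ∂₂ f ∈ L¹([a, b] × [c, d])`. -/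
structure MixedCondSnd (f : ℝ × ℝ → ℝ) (a b c d : ℝ) (e₂ : Set ℝ) : Prop where
  full : IsFullIn e₂ c d
  hasPartial : ∀ y ∈ e₂, ∀ x ∈ Icc a b, HasPartialSnd f (x, y)
  absCont : ∀ y ∈ e₂, AbsolutelyContinuousOnInterval (fun x => partialSnd f (x, y)) a b
  integrable : IntegrableOn (partialFst (partialSnd f)) (Icc a b ×ˢ Icc c d) volume

end

/-!
Both conditions are equivalent to a third one that treats the two variables alike: `f` has a mixed
density, that is, an integrable `g` on the plane such that for all `(x, y)` in the rectangle
`f (x, y) = f (a, y) + f (x, c) - f (a, c) + ∫ u in a..x, ∫ v in c..y, g (u, v)`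
(`IsMixedDensity`; the symmetry is Fubini's theorem, `IsMixedDensity.swap`).

If `∂₂ ∂₁ f` is as in the first condition, the fundamental theorem of calculus for absolutely
continuous functions, applied to `∂₁ f (x, ·)` and then to `f (·, y)`, shows that it is a mixed
density (`MixedCondFst.exists_isMixedDensity`).

Conversely, a mixed density determines the partial derivatives of `f`: for almost every `y`,
`∂₂ f (x, y) = ∂₂ f (a, y) + ∫ u in a..x, g (u, y)` for all `x` in `[a, b]` at once. The point is that
the exceptional null set does not depend on `x` (`ae_tendsto_average_primitive`). For `g ≥ 0` the
averages `(v - y)⁻¹ * ∫ t in y..v, ∫ u in a..x, g (u, t)` are monotone in `x`; Lebesgue's theorem gives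
their convergence for rational `x`, and the continuity of the limit in `x` extends it to all `x`,
locally uniformly.

By this local uniformity `f` is differentiable at almost every point
(`differentiableAt_of_hasDerivAt_of_tendsto`). Differentiating the formula for `∂₂ f` once more in `x`,
and the one for `∂₁ f` in `y`, shows that both mixed derivatives exist and equal `g` almost everywhere
in the rectangle (`ae_hasDerivAt_primitive_snd`).
-/

open Filter Topology

/-! ### Averages of an integrable function of two variables -/

theorem MeasureTheory.Integrable.comp_swap_volume {g : ℝ × ℝ → ℝ} (hg : Integrable g) :
    Integrable (g ∘ Prod.swap) := by
  rw [Measure.volume_eq_prod] at hg ⊢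
  exact hg.swap

theorem ae_comp_swap_volume {P : ℝ × ℝ → Prop} (h : ∀ᵐ p, P p) : ∀ᵐ p : ℝ × ℝ, P p.swap := by
  rw [Measure.volume_eq_prod] at h ⊢
  exact Measure.measurePreserving_swap.quasiMeasurePreserving.ae h

theorem MeasureTheory.Integrable.ae_integrable_fst {g : ℝ × ℝ → ℝ} (hg : Integrable g) :
    ∀ᵐ y, Integrable fun u => g (u, y) := by
  rw [Measure.volume_eq_prod] at hg
  exact hg.prod_left_ae

theorem MeasureTheory.Integrable.ae_integrable_snd {g : ℝ × ℝ → ℝ} (hg : Integrable g) :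
    ∀ᵐ x, Integrable fun v => g (x, v) :=
  hg.comp_swap_volume.ae_integrable_fst

theorem MeasureTheory.Integrable.integrable_intervalIntegral_fst {g : ℝ × ℝ → ℝ}
    (hg : Integrable g) (a x : ℝ) : Integrable fun t => ∫ u in a..x, g (u, t) := by
  have key (s : Set ℝ) : Integrable fun t => ∫ u in s, g (u, t) := by
    have h := hg.integrableOn (s := s ×ˢ univ)
    rw [IntegrableOn, Measure.volume_eq_prod, ← Measure.prod_restrict,
      Measure.restrict_univ] at h
    exact h.integral_prod_right
  simp only [intervalIntegral]
  exact (key _).sub (key _)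

/-- Averages over the interval between `y` and `v`, on either side of `y`, are monotone in the
integrand. -/
theorem average_intervalIntegral_mono {F G : ℝ → ℝ} (hF : Integrable F) (hG : Integrable G)
    (h : F ≤ᵐ[volume] G) (y v : ℝ) :
    (v - y)⁻¹ * ∫ t in y..v, F t ≤ (v - y)⁻¹ * ∫ t in y..v, G t := by
  rcases le_total y v with hv | hv
  · have := intervalIntegral.integral_mono_ae hv hF.intervalIntegrable hG.intervalIntegrable h
    have h2 : 0 ≤ (v - y)⁻¹ := inv_nonneg.2 (sub_nonneg.2 hv)
    gcongr
  · have := intervalIntegral.integral_mono_ae hv hF.intervalIntegrable hG.intervalIntegrable h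
    rw [intervalIntegral.integral_symm v y, intervalIntegral.integral_symm v y]
    have h2 : (v - y)⁻¹ ≤ 0 := inv_nonpos.2 (sub_nonpos.2 hv)
    exact mul_le_mul_of_nonpos_left (neg_le_neg this) h2

/-- The nonnegative case of `ae_tendsto_average_primitive`. The averages increase with the first
variable, so a limit at the countably many rational values of that variable, together with the
continuity of the limit, forces a limit that is locally uniform in it. -/
theorem ae_tendsto_average_primitive_of_nonneg {g : ℝ × ℝ → ℝ} (hg : Integrable g) (h0 : 0 ≤ g)
    (a : ℝ) : ∀ᵐ y, ∀ x₀, Tendsto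
      (fun p : ℝ × ℝ => (p.2 - y)⁻¹ * ∫ t in y..p.2, ∫ u in a..p.1, g (u, t))
      (𝓝 x₀ ×ˢ 𝓝[≠] y) (𝓝 (∫ u in a..x₀, g (u, y))) := by
  have hint := hg.integrable_intervalIntegral_fst a
  have hmono : ∀ x x', x ≤ x' →
      (fun t => ∫ u in a..x, g (u, t)) ≤ᵐ[volume] fun t => ∫ u in a..x', g (u, t) := by
    intro x x' hx
    filter_upwards [hg.ae_integrable_fst] with t ht
    have hadd := intervalIntegral.integral_add_adjacent_intervals
      (ht.intervalIntegrable (a := a) (b := x)) (ht.intervalIntegrable (a := x) (b := x'))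
    have : 0 ≤ ∫ u in x..x', g (u, t) :=
      intervalIntegral.integral_nonneg hx fun u _ => h0 (u, t)
    linarith
  have hrat : ∀ᵐ y, ∀ q : ℚ, ∀ c, HasDerivAt
      (fun v => ∫ t in c..v, ∫ u in a..(q : ℝ), g (u, t)) (∫ u in a..(q : ℝ), g (u, y)) y :=
    ae_all_iff.2 fun q => LocallyIntegrable.ae_hasDerivAt_integral (hint q).locallyIntegrable
  filter_upwards [hrat, hg.ae_integrable_fst] with y hy hgy x₀
  have hcont : Continuous fun x => ∫ u in a..x, g (u, y) :=
    intervalIntegral.continuous_primitive (fun _ _ => hgy.intervalIntegrable) a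
  have hq (q : ℚ) : Tendsto (fun v => (v - y)⁻¹ * ∫ t in y..v, ∫ u in a..(q : ℝ), g (u, t))
      (𝓝[≠] y) (𝓝 (∫ u in a..(q : ℝ), g (u, y))) := by
    simpa [slope_fun_def] using! hasDerivAt_iff_tendsto_slope.1 (hy q y)
  rw [tendsto_order]
  constructor
  · intro l hl
    obtain ⟨δ, hδ, hδl⟩ := Metric.eventually_nhds_iff.1 (hcont.continuousAt.eventually_const_lt hl)
    obtain ⟨q, hq1, hq2⟩ := exists_rat_btwn (sub_lt_self x₀ hδ)
    have hlq : l < ∫ u in a..(q : ℝ), g (u, y) :=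
      hδl (by rw [Real.dist_eq, abs_lt]; constructor <;> linarith)
    filter_upwards [prod_mem_prod (Ioi_mem_nhds hq2) ((hq q).eventually_const_lt hlq)] with p hp
    exact lt_of_lt_of_le hp.2
      (average_intervalIntegral_mono (hint _) (hint _) (hmono _ _ (le_of_lt hp.1)) _ _)
  · intro l hl
    obtain ⟨δ, hδ, hδl⟩ := Metric.eventually_nhds_iff.1 (hcont.continuousAt.eventually_lt_const hl)
    obtain ⟨q, hq1, hq2⟩ := exists_rat_btwn (lt_add_of_pos_right x₀ hδ)
    have hlq : ∫ u in a..(q : ℝ), g (u, y) < l :=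
      hδl (by rw [Real.dist_eq, abs_lt]; constructor <;> linarith)
    filter_upwards [prod_mem_prod (Iio_mem_nhds hq1) ((hq q).eventually_lt_const hlq)] with p hp
    exact lt_of_le_of_lt
      (average_intervalIntegral_mono (hint _) (hint _) (hmono _ _ (le_of_lt hp.1)) _ _) hp.2

/-- Lebesgue's differentiation theorem in the second variable for the primitive of `g` in the
first variable: the exceptional null set does not depend on the first variable, and the limit is
locally uniform in it. -/
theorem ae_tendsto_average_primitive {g : ℝ × ℝ → ℝ} (hg : Integrable g) (a : ℝ) :
    ∀ᵐ y, ∀ x₀, Tendsto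
      (fun p : ℝ × ℝ => (p.2 - y)⁻¹ * ∫ t in y..p.2, ∫ u in a..p.1, g (u, t))
      (𝓝 x₀ ×ˢ 𝓝[≠] y) (𝓝 (∫ u in a..x₀, g (u, y))) := by
  have hp := hg.pos_part
  have hn := hg.neg_part
  have hsub (p : ℝ × ℝ) : g p = max (g p) 0 - max (-g p) 0 := by
    rcases le_total 0 (g p) with h | h <;> simp [h]
  have hsec (x : ℝ) : ∀ᵐ t, ∫ u in a..x, g (u, t) =
      (∫ u in a..x, max (g (u, t)) 0) - ∫ u in a..x, max (-g (u, t)) 0 := by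
    filter_upwards [hp.ae_integrable_fst, hn.ae_integrable_fst] with t h1 h2
    rw [← intervalIntegral.integral_sub h1.intervalIntegrable h2.intervalIntegrable]
    simp only [← hsub]
  filter_upwards [ae_tendsto_average_primitive_of_nonneg hp (fun p => le_max_right _ _) a,
    ae_tendsto_average_primitive_of_nonneg hn (fun p => le_max_right _ _) a,
    hp.ae_integrable_fst, hn.ae_integrable_fst] with y hpy hny h1 h2 x₀
  have hval : ∫ u in a..x₀, g (u, y) =
      (∫ u in a..x₀, max (g (u, y)) 0) - ∫ u in a..x₀, max (-g (u, y)) 0 := by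
    rw [← intervalIntegral.integral_sub h1.intervalIntegrable h2.intervalIntegrable]
    simp only [← hsub]
  rw [hval]
  refine ((hpy x₀).sub (hny x₀)).congr fun p => ?_
  rw [← mul_sub, ← intervalIntegral.integral_sub
    (hp.integrable_intervalIntegral_fst _ _).intervalIntegrable
    (hn.integrable_intervalIntegral_fst _ _).intervalIntegrable]
  congr 1
  refine intervalIntegral.integral_congr_ae ?_
  filter_upwards [hsec p.1] with t ht _
  exact ht.symm

/-! ### Differentiating a primitive in one variable at almost every point of the plane -/

/-- The limit at `0` of a function continuous off `0` can be computed along rational arguments. -/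
theorem tendsto_nhdsNE_zero_of_rat {G : ℝ → ℝ} (hG : ContinuousOn G {0}ᶜ) {l : ℝ}
    (h : Tendsto (fun q : ℚ => G q) (comap (fun q : ℚ => (q : ℝ)) (𝓝[≠] 0)) (𝓝 l)) :
    Tendsto G (𝓝[≠] 0) (𝓝 l) := by
  refine (closed_nhds_basis l).tendsto_right_iff.2 fun C hC => ?_
  obtain ⟨t, ht, hts⟩ := mem_comap.1 (h hC.1)
  obtain ⟨U, hUo, h0U, hU⟩ := mem_nhdsWithin.1 ht
  refine mem_nhdsWithin.2 ⟨U, hUo, h0U, fun z hz => ?_⟩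
  have hzc : z ∈ closure ((U ∩ {0}ᶜ) ∩ range ((↑) : ℚ → ℝ)) :=
    Rat.isDenseEmbedding_coe_real.dense.open_subset_closure_inter
      (hUo.inter isOpen_compl_singleton) hz
  have hcw : ContinuousWithinAt G ((U ∩ {0}ᶜ) ∩ range ((↑) : ℚ → ℝ)) z :=
    (hG z hz.2).mono fun w hw => hw.1.2
  refine hC.2.closure_subset (hcw.mem_closure hzc ?_)
  rintro _ ⟨hw, q, rfl⟩
  exact hts (hU hw)

/-- For almost every point `(x, y)` of the plane, the primitive of `g (x, ·)` has derivative
`g (x, y)` at `y`. For each fixed `x` this is Lebesgue's theorem; by the continuity of primitives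
the derivative is a limit along rational increments, which makes the set of such points
measurable, so that Fubini's theorem applies. -/
theorem ae_hasDerivAt_primitive_snd {g : ℝ × ℝ → ℝ} (hg : Integrable g)
    (hm : StronglyMeasurable g) (c : ℝ) :
    ∀ᵐ p : ℝ × ℝ, HasDerivAt (fun y => ∫ v in c..y, g (p.1, v)) (g p) p.2 := by
  have hJ : Measurable fun p : ℝ × ℝ => ∫ v in Iic p.2, g (p.1, v) := by
    have : StronglyMeasurable (Function.uncurry fun (p : ℝ × ℝ) (v : ℝ) =>
        (Iic p.2).indicator (fun v => g (p.1, v)) v) := by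
      have h1 : MeasurableSet {z : (ℝ × ℝ) × ℝ | z.2 ≤ z.1.2} :=
        measurableSet_le measurable_snd (measurable_snd.comp measurable_fst)
      have h2 : StronglyMeasurable fun z : (ℝ × ℝ) × ℝ => g (z.1.1, z.2) :=
        hm.comp_measurable (by fun_prop)
      exact h2.indicator h1
    simpa only [integral_indicator measurableSet_Iic] using this.integral_prod_right.measurable
  let l : Filter ℚ := comap (fun q : ℚ => (q : ℝ)) (𝓝[≠] 0)
  let S : Set (ℝ × ℝ) := {p | Tendsto (fun q : ℚ => (q : ℝ)⁻¹ *
    ((∫ v in Iic (p.2 + q), g (p.1, v)) - ∫ v in Iic p.2, g (p.1, v)) - g p) l (𝓝 0)}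
  have hS : MeasurableSet S := by
    refine measurableSet_tendsto (𝓝 0) fun q => ?_
    refine (Measurable.const_mul (Measurable.sub ?_ hJ) _).sub hm.measurable
    exact hJ.comp (measurable_fst.prodMk (measurable_snd.add_const _))
  have hslope {x : ℝ} (hx : Integrable fun v => g (x, v)) (y h : ℝ) :
      h⁻¹ * ((∫ v in Iic (y + h), g (x, v)) - ∫ v in Iic y, g (x, v)) =
        h⁻¹ * ((∫ v in c..(y + h), g (x, v)) - ∫ v in c..y, g (x, v)) := by
    rw [intervalIntegral.integral_Iic_sub_Iic hx.integrableOn hx.integrableOn,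
      intervalIntegral.integral_interval_sub_left hx.intervalIntegrable hx.intervalIntegrable]
  have hSae : ∀ᵐ p : ℝ × ℝ, p ∈ S := by
    rw [Measure.volume_eq_prod, Measure.ae_prod_mem_iff_ae_ae_mem hS]
    filter_upwards [hg.ae_integrable_snd] with x hx
    filter_upwards [LocallyIntegrable.ae_hasDerivAt_integral hx.locallyIntegrable] with y hy
    have h1 := (hasDerivAt_iff_tendsto_slope_zero.1 (hy c)).sub_const (g (x, y))
    rw [sub_self] at h1
    refine (h1.comp tendsto_comap).congr fun q => ?_
    simp only [Function.comp_apply, smul_eq_mul, hslope hx]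
  have hsec : ∀ᵐ p : ℝ × ℝ, Integrable fun v => g (p.1, v) := by
    rw [Measure.volume_eq_prod]
    exact Measure.quasiMeasurePreserving_fst.ae hg.ae_integrable_snd
  filter_upwards [hSae, hsec] with p hp hx
  rw [hasDerivAt_iff_tendsto_slope_zero]
  have hcont : Continuous fun y => ∫ v in c..y, g (p.1, v) :=
    intervalIntegral.continuous_primitive (fun _ _ => hx.intervalIntegrable) c
  refine tendsto_nhdsNE_zero_of_rat ?_ ?_
  · have h1 : ContinuousOn (fun h : ℝ => h⁻¹) {0}ᶜ := continuousOn_inv₀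
    exact h1.smul (by fun_prop)
  · have h1 := (show Tendsto (fun q : ℚ => (q : ℝ)⁻¹ *
      ((∫ v in Iic (p.2 + q), g (p.1, v)) - ∫ v in Iic p.2, g (p.1, v)) - g p) l (𝓝 0)
      from hp).add_const (g p)
    rw [zero_add] at h1
    refine h1.congr fun q => ?_
    simp only [smul_eq_mul, hslope hx, sub_add_cancel]

/-! ### A criterion for total differentiability -/

/-- A function that is differentiable in the first variable at a point, and whose difference
quotients in the second variable converge locally uniformly in the first one, is differentiable
there. -/
theorem differentiableAt_of_hasDerivAt_of_tendsto {f : ℝ × ℝ → ℝ} {x₀ y₀ α β : ℝ}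
    (hx : HasDerivAt (fun u => f (u, y₀)) α x₀)
    (hy : Tendsto (fun p : ℝ × ℝ => (p.2 - y₀)⁻¹ * (f (p.1, p.2) - f (p.1, y₀)))
      (𝓝 x₀ ×ˢ 𝓝[≠] y₀) (𝓝 β)) : DifferentiableAt ℝ f (x₀, y₀) := by
  suffices h : HasFDerivAt f
      (α • ContinuousLinearMap.fst ℝ ℝ ℝ + β • ContinuousLinearMap.snd ℝ ℝ ℝ) (x₀, y₀) from
    h.differentiableAt
  rw [hasFDerivAt_iff_isLittleO, Asymptotics.isLittleO_iff]
  intro ε hε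
  have h1 := (Asymptotics.isLittleO_iff.1 (hasDerivAt_iff_isLittleO.1 hx)) (half_pos hε)
  have h2 := Metric.tendsto_nhds.1 hy _ (half_pos hε)
  rw [nhds_prod_eq]
  have h2' : ∀ᶠ p : ℝ × ℝ in 𝓝 x₀ ×ˢ 𝓝 y₀,
      |f (p.1, p.2) - f (p.1, y₀) - β * (p.2 - y₀)| ≤ ε / 2 * |p.2 - y₀| := by
    obtain ⟨s, hs, t, ht, hst⟩ := mem_prod_iff.1 h2
    filter_upwards [prod_mem_prod hs (mem_nhdsWithin_iff_eventually.1 ht)] with p hp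
    by_cases hpy : p.2 = y₀
    · simp [hpy]
    have hne : p.2 - y₀ ≠ 0 := sub_ne_zero.2 hpy
    have h3 : |(p.2 - y₀)⁻¹ * (f (p.1, p.2) - f (p.1, y₀)) - β| < ε / 2 :=
      hst (show p ∈ s ×ˢ t from ⟨hp.1, hp.2 hpy⟩)
    have h4 : f (p.1, p.2) - f (p.1, y₀) - β * (p.2 - y₀) =
        ((p.2 - y₀)⁻¹ * (f (p.1, p.2) - f (p.1, y₀)) - β) * (p.2 - y₀) := by
      field_simp
    rw [h4, abs_mul]
    gcongr
  filter_upwards [h2', h1.prod_inl (𝓝 y₀)] with p hp2 hp1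
  simp only [Real.norm_eq_abs, smul_eq_mul] at hp1
  have e1 : |p.1 - x₀| ≤ ‖p - (x₀, y₀)‖ := norm_fst_le (p - (x₀, y₀))
  have e2 : |p.2 - y₀| ≤ ‖p - (x₀, y₀)‖ := norm_snd_le (p - (x₀, y₀))
  have e3 : f p - f (x₀, y₀) - (α • ContinuousLinearMap.fst ℝ ℝ ℝ +
      β • ContinuousLinearMap.snd ℝ ℝ ℝ) (p - (x₀, y₀)) =
      (f (p.1, p.2) - f (p.1, y₀) - β * (p.2 - y₀)) +
        (f (p.1, y₀) - f (x₀, y₀) - (p.1 - x₀) * α) := by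
    simp
    ring
  rw [e3, Real.norm_eq_abs]
  calc _ ≤ _ := abs_add_le _ _
    _ ≤ ε / 2 * |p.2 - y₀| + ε / 2 * |p.1 - x₀| := add_le_add hp2 hp1
    _ ≤ ε / 2 * ‖p - (x₀, y₀)‖ + ε / 2 * ‖p - (x₀, y₀)‖ := by gcongr
    _ = _ := by ring

/-! ### Mixed densities -/

theorem AbsolutelyContinuousOnInterval.congr {f g : ℝ → ℝ} {a b : ℝ}
    (hf : AbsolutelyContinuousOnInterval f a b) (h : EqOn f g (uIcc a b)) :
    AbsolutelyContinuousOnInterval g a b := by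
  refine Tendsto.congr' ?_ hf
  filter_upwards [mem_inf_of_right (mem_principal_self _)] with E hE
  exact Finset.sum_congr rfl fun i hi => by rw [h (hE.1 i hi).1, h (hE.1 i hi).2]

theorem exists_isFullIn_of_ae {P : ℝ → Prop} {a b : ℝ} (h : ∀ᵐ x, x ∈ Ioo a b → P x) :
    ∃ e, IsFullIn e a b ∧ ∀ x ∈ e, P x := by
  obtain ⟨t, htP, htm, ht0⟩ := exists_measurable_superset_of_null (ae_iff.1 h)
  refine ⟨Ioo a b \ t, ⟨sdiff_subset, (measurableSet_Ioo.diff htm).nullMeasurableSet, ?_⟩, ?_⟩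
  · rw [measure_sdiff_null ht0, Real.volume_Ioo]
  · intro x hx
    by_contra hP
    exact hx.2 (htP fun h => hP (h hx.1))

theorem IsFullIn.ae_mem {e : Set ℝ} {a b : ℝ} (h : IsFullIn e a b) :
    ∀ᵐ x, x ∈ Ioo a b → x ∈ e := by
  have h0 : volume (Ioo a b \ e) = 0 := by
    rw [measure_sdiff h.subset h.measurable (by simp [h.measure_eq]), h.measure_eq,
      Real.volume_Ioo, tsub_self]
  filter_upwards [measure_eq_zero_iff_ae_notMem.1 h0] with x hx hxI
  by_contra hxe
  exact hx ⟨hxI, hxe⟩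

theorem ae_fst_of_ae {P : ℝ → Prop} (h : ∀ᵐ x, P x) : ∀ᵐ p : ℝ × ℝ, P p.1 := by
  rw [Measure.volume_eq_prod]
  exact Measure.quasiMeasurePreserving_fst.ae h

theorem ae_snd_of_ae {P : ℝ → Prop} (h : ∀ᵐ x, P x) : ∀ᵐ p : ℝ × ℝ, P p.2 := by
  rw [Measure.volume_eq_prod]
  exact Measure.quasiMeasurePreserving_snd.ae h

theorem Ioo_prod_ae_eq_Icc_prod (a b c d : ℝ) :
    (Ioo a b ×ˢ Ioo c d : Set (ℝ × ℝ)) =ᵐ[volume] Icc a b ×ˢ Icc c d := by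
  rw [Measure.volume_eq_prod]
  exact Measure.set_prod_ae_eq Ioo_ae_eq_Icc Ioo_ae_eq_Icc

/-- `g` is a mixed density of `f` on `[a, b] × [c, d]`: it is integrable on the plane, and the
increment of `f` over each rectangle with lower left corner `(a, c)` is the integral of `g` over
that rectangle. This notion is symmetric in the two variables. -/
structure IsMixedDensity (f g : ℝ × ℝ → ℝ) (a b c d : ℝ) : Prop where
  integrable : Integrable g
  stronglyMeasurable : StronglyMeasurable g
  eq_add_integral : ∀ x ∈ Icc a b, ∀ y ∈ Icc c d,
    f (x, y) = f (a, y) + f (x, c) - f (a, c) + ∫ u in a..x, ∫ v in c..y, g (u, v)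

namespace IsMixedDensity

variable {f g : ℝ × ℝ → ℝ} {a b c d : ℝ}

theorem integral_swap (h : IsMixedDensity f g a b c d) (x x' y y' : ℝ) :
    ∫ u in x..x', ∫ v in y..y', g (u, v) = ∫ v in y..y', ∫ u in x..x', g (u, v) := by
  refine intervalIntegral_intervalIntegral_swap (F := fun u v => g (u, v)) ?_
  exact h.integrable.integrableOn

theorem swap (h : IsMixedDensity f g a b c d) :
    IsMixedDensity (f ∘ Prod.swap) (g ∘ Prod.swap) c d a b where
  integrable := h.integrable.comp_swap_volume
  stronglyMeasurable := h.stronglyMeasurable.comp_measurable measurable_swap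
  eq_add_integral x hx y hy := by
    simp only [Function.comp_apply, Prod.swap_prod_mk]
    rw [h.eq_add_integral y hy x hx, h.integral_swap]
    ring

/-- At almost every height `y` the difference quotients of `f` in the second variable converge,
locally uniformly in the first variable, to a function absolutely continuous in it. -/
theorem ae_tendsto_slope_snd (h : IsMixedDensity f g a b c d)
    (hfa : AbsolutelyContinuousOnInterval (fun y => f (a, y)) c d) :
    ∀ᵐ y, y ∈ Ioo c d → ∀ x₀, Tendsto
      (fun p : ℝ × ℝ => (p.2 - y)⁻¹ * (f (p.1, p.2) - f (p.1, y))) (𝓝[Icc a b] x₀ ×ˢ 𝓝[≠] y)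
      (𝓝 (deriv (fun v => f (a, v)) y + ∫ u in a..x₀, g (u, y))) := by
  filter_upwards [ae_tendsto_average_primitive h.integrable a, hfa.ae_differentiableAt]
    with y hy hdy hyI x₀
  have hya : Tendsto (fun v => (v - y)⁻¹ * (f (a, v) - f (a, y))) (𝓝[≠] y)
      (𝓝 (deriv (fun v => f (a, v)) y)) := by
    have hd := (hdy (Icc_subset_uIcc (Ioo_subset_Icc_self hyI))).hasDerivAt
    simpa [slope_fun_def] using! hasDerivAt_iff_tendsto_slope.1 hd
  have hlim := (hya.comp (tendsto_snd (f := 𝓝[Icc a b] x₀))).add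
    ((hy x₀).mono_left (Filter.prod_mono_left _ nhdsWithin_le_nhds))
  refine hlim.congr' ?_
  filter_upwards [prod_mem_prod self_mem_nhdsWithin
    (mem_nhdsWithin_of_mem_nhds (Icc_mem_nhds hyI.1 hyI.2))] with p hp
  have hsec := h.integrable.integrable_intervalIntegral_fst a p.1
  rw [Function.comp_apply, h.eq_add_integral p.1 hp.1 p.2 hp.2,
    h.eq_add_integral p.1 hp.1 y (Ioo_subset_Icc_self hyI), h.integral_swap, h.integral_swap,
    ← intervalIntegral.integral_interval_sub_left hsec.intervalIntegrable
      (hsec.intervalIntegrable (a := c) (b := y))]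
  ring

/-- For almost every `y`, the formula for `∂₂ f (x, y)` in terms of the mixed density holds for all
`x ∈ [a, b]` simultaneously. -/
theorem ae_hasDerivAt_snd (h : IsMixedDensity f g a b c d)
    (hfa : AbsolutelyContinuousOnInterval (fun y => f (a, y)) c d) :
    ∀ᵐ y, y ∈ Ioo c d → ∀ x ∈ Icc a b, HasDerivAt (fun v => f (x, v))
      (deriv (fun v => f (a, v)) y + ∫ u in a..x, g (u, y)) y := by
  filter_upwards [h.ae_tendsto_slope_snd hfa] with y hy hyI x hx
  rw [hasDerivAt_iff_tendsto_slope]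
  have hpair : Tendsto (fun v => (x, v)) (𝓝[≠] y) (𝓝[Icc a b] x ×ˢ 𝓝[≠] y) :=
    (tendsto_const_pure.mono_right (pure_le_nhdsWithin hx)).prodMk tendsto_id
  simpa [slope_fun_def, Function.comp_def] using! (hy hyI x).comp hpair

theorem ae_hasDerivAt_partialSnd (h : IsMixedDensity f g a b c d)
    (hfa : AbsolutelyContinuousOnInterval (fun y => f (a, y)) c d) :
    ∀ᵐ p : ℝ × ℝ, p ∈ Ioo a b ×ˢ Ioo c d →
      HasDerivAt (fun u => partialSnd f (u, p.2)) (g p) p.1 := by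
  have hprim := ae_comp_swap_volume
    (ae_hasDerivAt_primitive_snd h.swap.integrable h.swap.stronglyMeasurable a)
  filter_upwards [hprim, ae_snd_of_ae (h.ae_hasDerivAt_snd hfa)] with p hp hd hpI
  refine (hp.const_add (deriv (fun v => f (a, v)) p.2)).congr_of_eventuallyEq ?_
  filter_upwards [Icc_mem_nhds hpI.1.1 hpI.1.2] with x hx
  exact (hd hpI.2 x hx).deriv

theorem ae_hasDerivAt_partialFst (h : IsMixedDensity f g a b c d)
    (hfc : AbsolutelyContinuousOnInterval (fun x => f (x, c)) a b) :
    ∀ᵐ p : ℝ × ℝ, p ∈ Ioo a b ×ˢ Ioo c d →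
      HasDerivAt (fun v => partialFst f (p.1, v)) (g p) p.2 := by
  filter_upwards [ae_comp_swap_volume (h.swap.ae_hasDerivAt_partialSnd hfc)] with p hp hpI
  exact hp ⟨hpI.2, hpI.1⟩

theorem ae_differentiableAt (h : IsMixedDensity f g a b c d)
    (hfa : AbsolutelyContinuousOnInterval (fun y => f (a, y)) c d)
    (hfc : AbsolutelyContinuousOnInterval (fun x => f (x, c)) a b) :
    ∀ᵐ p : ℝ × ℝ, p ∈ Ioo a b ×ˢ Ioo c d → DifferentiableAt ℝ f p := by
  filter_upwards [ae_snd_of_ae (h.ae_tendsto_slope_snd hfa),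
    ae_fst_of_ae (h.swap.ae_hasDerivAt_snd hfc)] with p hp2 hp1 hpI
  have hlim := hp2 hpI.2 p.1
  rw [nhdsWithin_eq_nhds.2 (Icc_mem_nhds hpI.1.1 hpI.1.2)] at hlim
  exact differentiableAt_of_hasDerivAt_of_tendsto
    (hp1 hpI.1 p.2 (Ioo_subset_Icc_self hpI.2)) hlim

theorem exists_mixedCondSnd (h : IsMixedDensity f g a b c d) (hab : a ≤ b)
    (hfa : AbsolutelyContinuousOnInterval (fun y => f (a, y)) c d) :
    ∃ e₂, MixedCondSnd f a b c d e₂ := by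
  have hae : ∀ᵐ y, y ∈ Ioo c d → (Integrable fun u => g (u, y)) ∧
      ∀ x ∈ Icc a b, HasDerivAt (fun v => f (x, v))
        (deriv (fun v => f (a, v)) y + ∫ u in a..x, g (u, y)) y := by
    filter_upwards [h.ae_hasDerivAt_snd hfa, h.integrable.ae_integrable_fst] with y h1 h2 hyI
    exact ⟨h2, h1 hyI⟩
  obtain ⟨e₂, he₂, hP⟩ := exists_isFullIn_of_ae hae
  refine ⟨e₂, he₂, fun y hy x hx => ((hP y hy).2 x hx).differentiableAt, fun y hy => ?_, ?_⟩
  · have hac := (hP y hy).1.intervalIntegrable.absolutelyContinuousOnInterval_intervalIntegral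
      (left_mem_uIcc (a := a) (b := b))
    have hconst : AbsolutelyContinuousOnInterval
        (fun _ : ℝ => deriv (fun v => f (a, v)) y) a b :=
      (LipschitzWith.const _).lipschitzOnWith.absolutelyContinuousOnInterval
    refine (hconst.fun_add hac).congr fun x hx => ?_
    rw [uIcc_of_le hab] at hx
    exact ((hP y hy).2 x hx).deriv.symm
  · -- On the boundary the iterated derivative depends on values of `f` off the rectangle.
    rw [← integrableOn_congr_set_ae (Ioo_prod_ae_eq_Icc_prod a b c d)]
    refine h.integrable.integrableOn.congr ?_
    rw [EventuallyEq, ae_restrict_iff' (measurableSet_Ioo.prod measurableSet_Ioo)]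
    filter_upwards [h.ae_hasDerivAt_partialSnd hfa] with p hp hpI
    exact (hp hpI).deriv.symm

end IsMixedDensity

/-! ### The two conditions on the mixed derivatives -/

/-- The mixed derivative `∂₂ ∂₁ f` provided by `MixedCondFst` is a mixed density: integrate it
first in the second variable and then in the first. -/
theorem MixedCondFst.exists_isMixedDensity {f : ℝ × ℝ → ℝ} {a b c d : ℝ} {e₁ : Set ℝ}
    (hcd : c ≤ d)
    (hf_fst : ∀ y ∈ Icc c d, AbsolutelyContinuousOnInterval (fun x => f (x, y)) a b)
    (h : MixedCondFst f a b c d e₁) : ∃ g, IsMixedDensity f g a b c d := by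
  have hR : MeasurableSet (Icc a b ×ˢ Icc c d) := measurableSet_Icc.prod measurableSet_Icc
  have hI := (integrable_indicator_iff hR).2 h.integrable
  -- A Borel measurable representative of `∂₂ ∂₁ f`, extended by zero off the rectangle.
  let g := hI.1.mk
  have hg : _ =ᵐ[volume] g := hI.1.ae_eq_mk
  have hgI : Integrable g := hI.congr hg
  refine ⟨g, hgI, hI.1.stronglyMeasurable_mk, fun x hx y hy => ?_⟩
  have hsec : ∀ᵐ u, u ∈ Ioo a b → partialFst f (u, y) - partialFst f (u, c) =
      ∫ v in c..y, g (u, v) := by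
    rw [Measure.volume_eq_prod] at hg
    filter_upwards [h.full.ae_mem, Measure.ae_ae_of_ae_prod hg] with u hu hgu huI
    have hac := (h.absCont u (hu huI)).mono (c := c) (d := y)
      (uIcc_subset_uIcc_left (by rwa [uIcc_of_le hcd]))
    rw [← hac.integral_deriv_eq_sub]
    refine intervalIntegral.integral_congr_ae ?_
    filter_upwards [hgu] with v hv hvI
    rw [uIoc_of_le hy.1] at hvI
    rw [← hv, indicator_of_mem]
    · rfl
    · exact ⟨Ioo_subset_Icc_self huI, hvI.1.le, hvI.2.trans hy.2⟩
  have hsub : uIcc a x ⊆ uIcc a b := uIcc_subset_uIcc_left (Icc_subset_uIcc hx)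
  have hacy := (hf_fst y hy).mono hsub
  have hacc := (hf_fst c (left_mem_Icc.2 hcd)).mono hsub
  have hint : ∫ u in a..x, ∫ v in c..y, g (u, v) =
      (f (x, y) - f (a, y)) - (f (x, c) - f (a, c)) := by
    rw [← hacy.integral_deriv_eq_sub, ← hacc.integral_deriv_eq_sub,
      ← intervalIntegral.integral_sub hacy.intervalIntegrable_deriv hacc.intervalIntegrable_deriv]
    refine intervalIntegral.integral_congr_ae ?_
    filter_upwards [hsec, Measure.ae_ne volume b] with u hu hub huI
    rw [uIoc_of_le hx.1] at huI
    exact (hu ⟨huI.1, lt_of_le_of_ne (huI.2.trans hx.2) hub⟩).symm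
  rw [hint]
  ring

/-- Exchanging the variables turns the second condition into the first. Partial derivatives of
`f ∘ Prod.swap` are those of `f` by definition; only integrability needs an argument. -/
theorem MixedCondSnd.comp_swap {f : ℝ × ℝ → ℝ} {a b c d : ℝ} {e : Set ℝ}
    (h : MixedCondSnd f a b c d e) : MixedCondFst (f ∘ Prod.swap) c d a b e where
  full := h.full
  hasPartial := h.hasPartial
  absCont := h.absCont
  integrable := by
    have hsw : MeasurePreserving (Prod.swap : ℝ × ℝ → ℝ × ℝ) volume volume := by
      rw [Measure.volume_eq_prod]
      exact Measure.measurePreserving_swap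
    have := (hsw.integrableOn_comp_preimage
      MeasurableEquiv.prodComm.measurableEmbedding).2 h.integrable
    rwa [preimage_swap_prod] at this

theorem MixedCondFst.of_comp_swap {f : ℝ × ℝ → ℝ} {a b c d : ℝ} {e : Set ℝ}
    (h : MixedCondSnd (f ∘ Prod.swap) c d a b e) : MixedCondFst f a b c d e :=
  h.comp_swap

theorem mainTheorem2 (a b c d : ℝ) (hab : a < b) (hcd : c < d) (f : ℝ × ℝ → ℝ)
    (hf_snd : ∀ x ∈ Icc a b, AbsolutelyContinuousOnInterval (fun y => f (x, y)) c d)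
    (hf_fst : ∀ y ∈ Icc c d, AbsolutelyContinuousOnInterval (fun x => f (x, y)) a b) :
    ((∃ e₁ : Set ℝ, MixedCondFst f a b c d e₁) ↔ (∃ e₂ : Set ℝ, MixedCondSnd f a b c d e₂)) ∧
    (∀ e₁ e₂ : Set ℝ, MixedCondFst f a b c d e₁ → MixedCondSnd f a b c d e₂ →
      ∃ E : Set (ℝ × ℝ), E ⊆ e₁ ×ˢ e₂ ∧ MeasurableSet E ∧
        volume E = ENNReal.ofReal ((b - a) * (d - c)) ∧
        ∀ p ∈ E, DifferentiableAt ℝ f p ∧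
          HasPartialSnd (partialFst f) p ∧ HasPartialFst (partialSnd f) p ∧
          partialSnd (partialFst f) p = partialFst (partialSnd f) p) := by
  have hfa := hf_snd a (left_mem_Icc.2 hab.le)
  have hfc := hf_fst c (left_mem_Icc.2 hcd.le)
  refine ⟨⟨?_, ?_⟩, ?_⟩
  · rintro ⟨e₁, h₁⟩
    obtain ⟨g, hg⟩ := h₁.exists_isMixedDensity hcd.le hf_fst
    exact hg.exists_mixedCondSnd hab.le hfa
  · rintro ⟨e₂, h₂⟩
    have hf_snd' : ∀ x ∈ Icc a b,
        AbsolutelyContinuousOnInterval (fun y => (f ∘ Prod.swap) (y, x)) c d := hf_snd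
    have hfc' : AbsolutelyContinuousOnInterval (fun x => (f ∘ Prod.swap) (c, x)) a b := hfc
    obtain ⟨g, hg⟩ := h₂.comp_swap.exists_isMixedDensity hab.le hf_snd'
    obtain ⟨e₁, h₁⟩ := hg.exists_mixedCondSnd hcd.le hfc'
    exact ⟨e₁, MixedCondFst.of_comp_swap h₁⟩
  · intro e₁ e₂ h₁ h₂
    obtain ⟨g, hg⟩ := h₁.exists_isMixedDensity hcd.le hf_fst
    have hae : ∀ᵐ p : ℝ × ℝ, p ∈ Ioo a b ×ˢ Ioo c d → p ∈ e₁ ×ˢ e₂ ∧ DifferentiableAt ℝ f p ∧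
        HasPartialSnd (partialFst f) p ∧ HasPartialFst (partialSnd f) p ∧
        partialSnd (partialFst f) p = partialFst (partialSnd f) p := by
      filter_upwards [ae_fst_of_ae h₁.full.ae_mem, ae_snd_of_ae h₂.full.ae_mem,
        hg.ae_differentiableAt hfa hfc, hg.ae_hasDerivAt_partialFst hfc,
        hg.ae_hasDerivAt_partialSnd hfa] with p hp1 hp2 hd hd1 hd2 hpI
      exact ⟨⟨hp1 hpI.1, hp2 hpI.2⟩, hd hpI, (hd1 hpI).differentiableAt,
        (hd2 hpI).differentiableAt, (hd1 hpI).deriv.trans (hd2 hpI).deriv.symm⟩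
    obtain ⟨t, htP, htm, ht0⟩ := exists_measurable_superset_of_null (ae_iff.1 hae)
    have hE (p) (hp : p ∈ (Ioo a b ×ˢ Ioo c d) \ t) := by
      by_contra hP
      exact hp.2 (htP fun h => hP (h hp.1))
    refine ⟨(Ioo a b ×ˢ Ioo c d) \ t, fun p hp => (hE p hp).1,
      (measurableSet_Ioo.prod measurableSet_Ioo).diff htm, ?_, fun p hp => (hE p hp).2⟩
    rw [measure_sdiff_null ht0, Measure.volume_eq_prod, Measure.prod_prod, Real.volume_Ioo,
      Real.volume_Ioo, ← ENNReal.ofReal_mul (sub_nonneg.2 hab.le)]
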